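/- **Problem.** For finite simple graphs $G=(V_G,E_G)$ and $H=(V_H,E_H)$, a *common induced subgraph* of $G$ and $H$ is a function $f\colon V_G\to V_H\cup\{\bot\}$ such that, with $U=\{v\in V_G : f(v)\neq\bot\}$, the restriction $f|_U$ is an isomorphism from the induced subgraph $G[U]$ to the induced subgraph $H[f(U)]$. A *maximum common induced subgraph* (MCIS) is such an $f$ with $|U|$ as large as possible. The vertex cover number $\tau(\Gamma)$ of a graph $\Gamma$ is the minimum size of a set of vertices that meets every edge. **Model.** In the deterministic $\mathsf{CONGEST}$ model the communication network is a connected graph $G$ on $n\ge 1$ nodes. The nodes have distinct identifiers in $\{0,\dots,n^c-1\}$, where $c$ is a constant, and each node numbers its incident edges in an arbitrary way. All nodes run the same deterministic program in synchronous rounds, with unrestricted local computation; initially a node knows $n$, its own identifier and its degree. In each round every node may send a (possibly different) message of at most $\beta\lceil\log_2 n\rceil$ bits, where $\beta$ is a constant, over each of its incident edges, and then receives the messages of its neighbours. At some point every node must stop with a final local output. In distributed MCIS, every node also knows the whole graph $H$ from the start, and each node $v$ has to output $f(v)\in V_H\cup\{\bot\}$ so that the resulting global function $f$ is a maximum common induced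 subgraph of $G$ and $H$. **Theorem.** Maximum common induced subgraph on communication graph $G$ and target graph $H$ can be solved deterministically in the $\mathsf{CONGEST}$ model in $2^{O(\tau^2)}$ rounds, where $\tau=\max(\tau(G),\tau(H))$. Precisely: there is an absolute constant $C$ such that for every $c$ there are a constant $\beta$ and a deterministic program, using messages of at most $\beta\lceil\log_2 n\rceil$ bits, for which the following holds. For every connected graph $G$ with distinct identifiers in $\{0,\dots,n^c-1\}$ and every port numbering, and for every finite graph $H$ given to all nodes, all nodes stop within $2^{C\tau^2}$ rounds and their outputs form a maximum common induced subgraph of $G$ and $H$. (The value of $\tau(G)$ is not given to the nodes.) -/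

import Mathlib

/-! ### The deterministic `CONGEST` model -/

/-- A deterministic synchronous message-passing program, run by every node of the network.
Local computation is unrestricted, so the components are arbitrary functions.
A node with `d` neighbours has ports `0, …, d - 1`, one for each incident edge.
A message is a natural number (read as a bit string), and `none` is silence. -/
structure CongestAlgorithm (Output : Type) where
  /-- Local states. -/
  State : Type
  /-- Initial state, from the number of nodes, the node's own identifier, and its degree. -/
  init : (numNodes : ℕ) → (ident : ℕ) → (deg : ℕ) → State
  /-- The message sent through a given port, as a function of the current state. -/
  send : State → (port : ℕ) → Option ℕ
  /-- The new state, from the current one and the messages received through the ports. -/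
  receive : State → (inbox : ℕ → Option ℕ) → State
  /-- `some y` if the node has stopped with local output `y`, `none` if it is still running. -/
  output : State → Option Output

namespace CongestAlgorithm

variable {Output : Type} (A : CongestAlgorithm Output)

/-- The message actually sent: a stopped node is silent. -/
def message (s : A.State) (port : ℕ) : Option ℕ :=
  match A.output s with
  | some _ => none
  | none => A.send s port

/-- The state update actually made: the state (hence the output) of a stopped node is final. -/
def next (s : A.State) (inbox : ℕ → Option ℕ) : A.State :=
  match A.output s with
  | some _ => s
  | none => A.receive s inbox

end CongestAlgorithm

/-- The data that turn a graph `G` into a communication network: distinct identifiers that are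
smaller than `n ^ c`, where `n` is the number of nodes, and an arbitrary port numbering at
every node. -/
structure CongestNetwork {V : Type} [Fintype V] (G : SimpleGraph V) [DecidableRel G.Adj]
    (c : ℕ) where
  /-- Node identifiers. -/
  ident : V → ℕ
  ident_injective : Function.Injective ident
  ident_lt : ∀ v, ident v < Fintype.card V ^ c
  /-- The neighbour at the other end of each port. -/
  port : ∀ v, Fin (G.degree v) ≃ G.neighborSet v

namespace CongestNetwork

variable {V : Type} [Fintype V] {G : SimpleGraph V} [DecidableRel G.Adj] {c : ℕ}
  (N : CongestNetwork G c) {Output : Type} (A : CongestAlgorithm Output)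

/-- What the node `v` receives in a round at whose beginning the states are `s`: if port `i` of
`v` leads to `u`, then `v` gets through port `i` what `u` sends through its port towards `v`. -/
def inbox (s : V → A.State) (v : V) (i : ℕ) : Option ℕ :=
  if h : i < G.degree v then
    A.message (s (N.port v ⟨i, h⟩))
      ((N.port (N.port v ⟨i, h⟩)).symm ⟨v, SimpleGraph.Adj.symm (N.port v ⟨i, h⟩).2⟩ : ℕ)
  else none

/-- `N.state A t v` is the state of the node `v` after `t` synchronous rounds of `A`. -/
def state : ℕ → V → A.State
  | 0, v => A.init (Fintype.card V) (N.ident v) (G.degree v)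
  | t + 1, v => A.next (state t v) (N.inbox A (state t) v)

/-- In every round, every message over every edge has at most `β * ⌈log₂ n⌉` bits. -/
def RespectsBandwidth (β : ℕ) : Prop :=
  ∀ (t : ℕ) (v : V) (i : ℕ), i < G.degree v →
    ∀ m, A.message (N.state A t v) i = some m →
      Nat.size m ≤ β * Nat.clog 2 (Fintype.card V)

/-- After at most `T` rounds every node has stopped, and `f` is the function of local outputs. -/
def OutputsWithin (T : ℕ) (f : V → Output) : Prop :=
  ∀ v, A.output (N.state A T v) = some (f v)

end CongestNetwork

/-! ### Maximum common induced subgraph -/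

section MCIS

variable {V W : Type}

/-- The set of vertices that are mapped to something else than `⊥` (here `none`). -/
def mappedSet (f : V → Option W) : Set V := {v | f v ≠ none}

/-- The set of vertices of the target that are hit. -/
def imageSet (f : V → Option W) : Set W := {w | ∃ v, f v = some w}

/-- `f`, restricted to the vertices not mapped to `⊥`, is an isomorphism between the subgraphs
induced by its domain and by its image. -/
def IsCommonInducedSubgraph (G : SimpleGraph V) (H : SimpleGraph W) (f : V → Option W) : Prop :=
  ∃ e : G.induce (mappedSet f) ≃g H.induce (imageSet f),
    ∀ x : mappedSet f, f x = some (e x : W)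

/-- `f` is a common induced subgraph of `G` and `H` with the largest number of vertices. -/
def IsMaximumCommonInducedSubgraph (G : SimpleGraph V) (H : SimpleGraph W)
    (f : V → Option W) : Prop :=
  IsCommonInducedSubgraph G H f ∧
    ∀ g : V → Option W, IsCommonInducedSubgraph G H g →
      (mappedSet g).ncard ≤ (mappedSet f).ncard

end MCIS

/-! ### Common induced subgraphs: a pointwise criterion, existence, transport -/

section CommonInducedSubgraph

variable {V V' W : Type}

/-! Call a vertex a cover vertex if some neighbour has no larger degree. Every node decides this
after one round; these vertices form a vertex cover, and there are at most τ + τ² of them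
(`card_cover_le`). The other vertices are independent and split into 2^O(τ²) classes with equal
neighbourhoods. So G is determined up to isomorphism by 2^O(τ²) tokens of O(log n) bits, each naming
a class, two cardinalities and one cover vertex attached to the class (`card_allTokens_le`,
`labelIso`).

Cover nodes form the tokens from what their neighbours tell them, and all nodes flood them, one
token per round. Paths have length O(τ²) (`length_le_of_isPath`), so flooding takes time polynomial
in the number of tokens (`known_run_eq`).

As τ is unknown, completeness has to be detected locally. A token of a class of size w attached to d
cover vertices weighs w/d. Weights are positive and add up to n, so a node holds every token exactly
when its weights sum to n (`eq_allTokens_of_sum_share`). It then knows the number of tokens, which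
fixes a stopping time common to all nodes (`finished_run_iff`). All nodes choose the same optimum
for the rebuilt graph, and each evaluates it at its own label: its class and its position there
(`label_run`). -/

theorem isCommonInducedSubgraph_iff {G : SimpleGraph V} {H : SimpleGraph W} {f : V → Option W} :
    IsCommonInducedSubgraph G H f ↔
      ∀ u v a b, f u = some a → f v = some b → ((u = v ↔ a = b) ∧ (G.Adj u v ↔ H.Adj a b)) := by
  constructor
  · rintro ⟨e, he⟩ u v a b hu hv
    have hu' : u ∈ mappedSet f := by simp [mappedSet, hu]
    have hv' : v ∈ mappedSet f := by simp [mappedSet, hv]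
    have h1 : ((e ⟨u, hu'⟩ : imageSet f) : W) = a := by
      have := he ⟨u, hu'⟩
      simp only [hu, Option.some.injEq] at this
      exact this.symm
    have h2 : ((e ⟨v, hv'⟩ : imageSet f) : W) = b := by
      have := he ⟨v, hv'⟩
      simp only [hv, Option.some.injEq] at this
      exact this.symm
    constructor
    · rw [← h1, ← h2, ← Subtype.ext_iff, e.injective.eq_iff, Subtype.mk.injEq]
    · have := e.map_rel_iff (a := ⟨u, hu'⟩) (b := ⟨v, hv'⟩)
      simp only [SimpleGraph.comap_adj, Function.Embedding.subtype_apply] at this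
      rw [← h1, ← h2]
      exact this.symm
  · intro h
    have hsome : ∀ x : mappedSet f, ∃ a, f x = some a := fun x =>
      Option.ne_none_iff_exists'.mp x.2
    choose g hg using hsome
    have hbij : Function.Bijective (fun x : mappedSet f => (⟨g x, x, hg x⟩ : imageSet f)) := by
      constructor
      · intro x y hxy
        have hxy' : g x = g y := congrArg Subtype.val hxy
        exact Subtype.ext ((h x y _ _ (hg x) (hg y)).1.2 hxy')
      · rintro ⟨w, v, hv⟩
        refine ⟨⟨v, by simp [mappedSet, hv]⟩, Subtype.ext ?_⟩
        have := hg ⟨v, by simp [mappedSet, hv]⟩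
        simp only [hv, Option.some.injEq] at this
        exact this.symm
    refine ⟨⟨Equiv.ofBijective _ hbij, ?_⟩, fun x => hg x⟩
    intro x y
    exact (h x y _ _ (hg x) (hg y)).2.symm

theorem exists_isMaximumCommonInducedSubgraph [Finite V] [Finite W] (G : SimpleGraph V)
    (H : SimpleGraph W) : ∃ f : V → Option W, IsMaximumCommonInducedSubgraph G H f := by
  obtain ⟨f, hf, hmax⟩ := Set.exists_max_image
    {f : V → Option W | IsCommonInducedSubgraph G H f} (fun f => (mappedSet f).ncard)
    (Set.toFinite _)
    ⟨fun _ => none, isCommonInducedSubgraph_iff.2 fun _ _ _ _ h => by simp at h⟩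
  exact ⟨f, hf, hmax⟩

theorem IsCommonInducedSubgraph.comp_iso {G : SimpleGraph V} {G' : SimpleGraph V'}
    {H : SimpleGraph W} {f : V' → Option W} (hf : IsCommonInducedSubgraph G' H f) (e : G ≃g G') :
    IsCommonInducedSubgraph G H (f ∘ e) := by
  rw [isCommonInducedSubgraph_iff] at hf ⊢
  intro u v a b hu hv
  have := hf (e u) (e v) a b hu hv
  rwa [e.injective.eq_iff, e.map_adj_iff] at this

theorem ncard_mappedSet_comp_equiv (f : V' → Option W) (e : V ≃ V') :
    (mappedSet (f ∘ e)).ncard = (mappedSet f).ncard := by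
  have : mappedSet (f ∘ e) = e.symm '' mappedSet f := by
    ext v
    simp [mappedSet]
  rw [this, Set.ncard_image_of_injective _ e.symm.injective]

/-- Allows the nodes to solve the problem on the graph rebuilt from tokens and to pull the solution
back to the network. -/
theorem IsMaximumCommonInducedSubgraph.comp_iso {G : SimpleGraph V} {G' : SimpleGraph V'}
    {H : SimpleGraph W} {f : V' → Option W} (hf : IsMaximumCommonInducedSubgraph G' H f)
    (e : G ≃g G') : IsMaximumCommonInducedSubgraph G H (f ∘ e) := by
  refine ⟨hf.1.comp_iso e, fun g hg => ?_⟩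
  have h1 := hf.2 _ (hg.comp_iso e.symm)
  have h2 := ncard_mappedSet_comp_equiv g e.symm.toEquiv
  have h3 := ncard_mappedSet_comp_equiv f e.toEquiv
  change (mappedSet (f ∘ e)).ncard = _ at h3
  change (mappedSet (g ∘ e.symm)).ncard = _ at h2
  rw [h3, ← h2]
  exact h1

end CommonInducedSubgraph

/-! ### A locally determined vertex cover and the twin classes of its complement -/

/-- Representative, size, degree into the cover, and one neighbour in the cover, of a class. -/
abbrev ClassToken : Type := ℕ × ℕ × ℕ × ℕ

namespace DegreeCover

open scoped Classical in
/-- The vertices having a neighbour whose degree is not larger than their own. -/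
noncomputable def cover {V : Type} [Fintype V] (G : SimpleGraph V) [DecidableRel G.Adj] :
    Finset V :=
  Finset.univ.filter fun v => ∃ u, G.Adj v u ∧ G.degree u ≤ G.degree v

/-! ### The degree cover: size and path lengths -/

section Cover

variable {V : Type} [Fintype V] (G : SimpleGraph V) [DecidableRel G.Adj]

theorem mem_cover {v : V} : v ∈ cover G ↔ ∃ u, G.Adj v u ∧ G.degree u ≤ G.degree v := by
  simp [cover]

variable {G}

/-- All neighbours of a vertex outside the cover have strictly larger degree, so that vertex is
itself the witness for each of them. Thus the cover meets every edge. -/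
theorem mem_cover_of_adj {u v : V} (h : G.Adj u v) (hu : u ∉ cover G) : v ∈ cover G := by
  rw [mem_cover] at *
  push Not at hu
  exact ⟨u, h.symm, (hu v h).le⟩

/-- A cover vertex outside `S` has all its neighbours in `S`, so its degree is at most |S|. Its
witness is then a vertex of `S` of degree at most |S|, and such witnesses have at most |S|²
neighbours altogether. -/
theorem card_cover_le {S : Finset V} (hS : G.IsVertexCover S) :
    (cover G).card ≤ S.card + S.card ^ 2 := by
  classical
  have hsub : cover G ⊆ S ∪ (S.filter fun u => G.degree u ≤ S.card).biUnion
      fun u => G.neighborFinset u := by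
    intro v hv
    by_cases hvS : v ∈ S
    · exact Finset.mem_union_left _ hvS
    obtain ⟨u, hvu, hdeg⟩ := (mem_cover G).1 hv
    have hN : ∀ w, G.Adj v w → w ∈ S := by
      intro w hw
      have := hS hw
      simpa [hvS] using this
    have hd : G.degree v ≤ S.card := by
      rw [← SimpleGraph.card_neighborFinset_eq_degree]
      exact Finset.card_le_card fun w hw => hN w (by simpa using hw)
    refine Finset.mem_union_right _ (Finset.mem_biUnion.2 ⟨u, ?_, ?_⟩)
    · exact Finset.mem_filter.2 ⟨hN u hvu, hdeg.trans hd⟩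
    · simpa using hvu.symm
  refine (Finset.card_le_card hsub).trans ((Finset.card_union_le _ _).trans ?_)
  gcongr
  refine (Finset.card_biUnion_le_card_mul _ _ S.card ?_).trans ?_
  · intro u hu
    rw [SimpleGraph.card_neighborFinset_eq_degree]
    exact (Finset.mem_filter.1 hu).2
  · rw [sq]
    gcongr
    exact Finset.filter_subset _ _

/-- A path meets the cover in at least half of its steps. -/
theorem length_le_of_isPath {u v : V} (p : G.Walk u v) (hp : p.IsPath) :
    p.length ≤ 2 * (cover G).card := by
  classical
  -- The indicator of the starting vertex makes the induction work: a step leaving a vertex outside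
  -- the cover is paid for by the next vertex, which lies in the cover.
  have key : ∀ {u v : V} (p : G.Walk u v),
      p.length + (if u ∈ cover G then 1 else 0) ≤ 2 * p.support.countP (· ∈ cover G) := by
    intro u v p
    induction p with
    | @nil a => by_cases h : a ∈ cover G <;> simp [h]
    | @cons a b c hab q ih =>
      by_cases ha : a ∈ cover G
      · simp only [SimpleGraph.Walk.length_cons, SimpleGraph.Walk.support_cons, ha,
          List.countP_cons, if_true, decide_true]
        omega
      · have hb := mem_cover_of_adj hab ha
        simp only [SimpleGraph.Walk.length_cons, SimpleGraph.Walk.support_cons, ha, hb,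
          List.countP_cons, if_true, if_false, decide_false] at ih ⊢
        simp only [Bool.false_eq_true, if_false]
        omega
  have h1 := key p
  have h2 : p.support.countP (· ∈ cover G) ≤ (cover G).card := by
    rw [List.countP_eq_length_filter,
      ← List.toFinset_card_of_nodup (hp.support_nodup.filter _)]
    exact Finset.card_le_card fun x hx => by simpa using (List.mem_filter.1 (List.mem_toFinset.1 hx)).2
  omega

end Cover

/-! ### Twin classes, tokens and their weights -/

section Classes

variable {V : Type} [Fintype V] (G : SimpleGraph V) [DecidableRel G.Adj] (ι : V → ℕ)

open scoped Classical in
/-- The identifiers of the cover vertices in the closed neighbourhood of `v`. -/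
noncomputable def trace (v : V) : Finset ℕ :=
  ((cover G).filter fun x => x = v ∨ G.Adj x v).image ι

open scoped Classical in
/-- Cover vertices form classes of their own; other vertices are classified by their
neighbourhoods. -/
noncomputable def twinClass (v : V) : Finset V :=
  if v ∈ cover G then {v} else Finset.univ.filter fun u => u ∉ cover G ∧ trace G ι u = trace G ι v

/-- The smallest identifier in the class of `v`. -/
noncomputable def rep (v : V) : ℕ := sInf (ι '' (twinClass G ι v : Set V))

/-- The position of `v` in its class. -/
noncomputable def rank (v : V) : ℕ := ((twinClass G ι v).filter fun u => ι u < ι v).card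

/-- The tokens describing the class of `v`. -/
noncomputable def vertexTokens (v : V) : Finset ClassToken :=
  (trace G ι v).image fun x => (rep G ι v, (twinClass G ι v).card, (trace G ι v).card, x)

open scoped Classical in
/-- The tokens describing the whole graph. -/
noncomputable def allTokens : Finset ClassToken := Finset.univ.biUnion (vertexTokens G ι)

theorem mem_trace {v : V} {i : ℕ} :
    i ∈ trace G ι v ↔ ∃ x ∈ cover G, (x = v ∨ G.Adj x v) ∧ ι x = i := by
  simp [trace, and_assoc]

theorem card_trace_le (v : V) : (trace G ι v).card ≤ (cover G).card := by
  classical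
  rw [trace]
  exact Finset.card_image_le.trans (Finset.card_le_card fun _ hx => (Finset.mem_filter.1 hx).1)

theorem self_mem_twinClass (v : V) : v ∈ twinClass G ι v := by
  by_cases h : v ∈ cover G <;> simp [twinClass, h]

theorem card_twinClass_pos (v : V) : 0 < (twinClass G ι v).card :=
  Finset.card_pos.2 ⟨v, self_mem_twinClass G ι v⟩

theorem twinClass_of_mem {v : V} (h : v ∈ cover G) : twinClass G ι v = {v} := by
  simp [twinClass, h]

theorem mem_twinClass_of_notMem {u v : V} (h : v ∉ cover G) :
    u ∈ twinClass G ι v ↔ u ∉ cover G ∧ trace G ι u = trace G ι v := by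
  simp [twinClass, h]

theorem trace_eq_of_mem_twinClass {u v : V} (h : u ∈ twinClass G ι v) :
    trace G ι u = trace G ι v := by
  by_cases hv : v ∈ cover G
  · rw [twinClass_of_mem G ι hv, Finset.mem_singleton] at h
    rw [h]
  · exact ((mem_twinClass_of_notMem G ι hv).1 h).2

theorem twinClass_eq_of_mem {u v : V} (h : u ∈ twinClass G ι v) :
    twinClass G ι u = twinClass G ι v := by
  by_cases hv : v ∈ cover G
  · rw [twinClass_of_mem G ι hv, Finset.mem_singleton] at h
    rw [h]
  · have h' := (mem_twinClass_of_notMem G ι hv).1 h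
    ext w
    rw [mem_twinClass_of_notMem G ι hv, mem_twinClass_of_notMem G ι h'.1, h'.2]

theorem exists_rep (v : V) : ∃ u ∈ twinClass G ι v, ι u = rep G ι v := by
  have : rep G ι v ∈ ι '' (twinClass G ι v : Set V) :=
    Nat.sInf_mem ⟨_, v, self_mem_twinClass G ι v, rfl⟩
  simpa using this

theorem rep_of_mem {v : V} (h : v ∈ cover G) : rep G ι v = ι v := by
  simp [rep, twinClass_of_mem G ι h]

theorem rank_of_mem {v : V} (h : v ∈ cover G) : rank G ι v = 0 := by
  simp [rank, twinClass_of_mem G ι h]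

theorem rank_lt (v : V) : rank G ι v < (twinClass G ι v).card :=
  Finset.card_lt_card <| Finset.filter_ssubset.2 ⟨v, self_mem_twinClass G ι v, lt_irrefl _⟩

theorem card_twinClass_le (v : V) : (twinClass G ι v).card ≤ Fintype.card V :=
  Finset.card_le_univ _

theorem mem_vertexTokens {v : V} {t : ClassToken} :
    t ∈ vertexTokens G ι v ↔
      ∃ x ∈ trace G ι v, (rep G ι v, (twinClass G ι v).card, (trace G ι v).card, x) = t := by
  simp [vertexTokens]

theorem mem_allTokens {t : ClassToken} : t ∈ allTokens G ι ↔ ∃ v, t ∈ vertexTokens G ι v := by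
  simp [allTokens]

theorem vertexTokens_subset (v : V) : vertexTokens G ι v ⊆ allTokens G ι :=
  fun _ ht => (mem_allTokens G ι).2 ⟨v, ht⟩

variable {ι} (hι : Function.Injective ι)
include hι

theorem mem_trace_iff {x v : V} :
    ι x ∈ trace G ι v ↔ x ∈ cover G ∧ (x = v ∨ G.Adj x v) := by
  rw [mem_trace]
  constructor
  · rintro ⟨y, hy, h, hxy⟩
    obtain rfl := hι hxy
    exact ⟨hy, h⟩
  · rintro ⟨h1, h2⟩
    exact ⟨x, h1, h2, rfl⟩

omit hι in
theorem trace_of_notMem {v : V} (hv : v ∉ cover G) :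
    trace G ι v = (G.neighborFinset v).image ι := by
  ext i
  rw [mem_trace, Finset.mem_image]
  constructor
  · rintro ⟨x, hx, rfl | h, rfl⟩
    · exact absurd hx hv
    · exact ⟨x, by simpa using h.symm, rfl⟩
  · rintro ⟨x, hx, rfl⟩
    rw [SimpleGraph.mem_neighborFinset] at hx
    exact ⟨x, mem_cover_of_adj hx hv, Or.inr hx.symm, rfl⟩

omit hι in
theorem degree_le_of_notMem {v : V} (hv : v ∉ cover G) : G.degree v ≤ (cover G).card := by
  rw [← SimpleGraph.card_neighborFinset_eq_degree]
  refine Finset.card_le_card fun w hw => ?_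
  rw [SimpleGraph.mem_neighborFinset] at hw
  exact mem_cover_of_adj hw hv

theorem rep_eq_rep_iff {u v : V} : rep G ι u = rep G ι v ↔ u ∈ twinClass G ι v := by
  constructor
  · intro h
    obtain ⟨a, ha, ha'⟩ := exists_rep G ι u
    obtain ⟨b, hb, hb'⟩ := exists_rep G ι v
    have hab : a = b := hι (by rw [ha', hb', h])
    subst hab
    rw [← twinClass_eq_of_mem G ι hb, twinClass_eq_of_mem G ι ha]
    exact self_mem_twinClass G ι u
  · intro h
    rw [rep, rep, twinClass_eq_of_mem G ι h]

/-- Adjacency can be read from class representatives: the representative of a cover vertex is that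
vertex, and no other class has a representative in the cover. -/
theorem mem_trace_rep_iff {u v : V} :
    rep G ι u ∈ trace G ι v ↔ u ∈ cover G ∧ (u = v ∨ G.Adj u v) := by
  obtain ⟨a, ha, ha'⟩ := exists_rep G ι u
  rw [← ha', mem_trace_iff G hι]
  by_cases hu : u ∈ cover G
  · rw [twinClass_of_mem G ι hu, Finset.mem_singleton] at ha
    rw [ha]
  · have := ((mem_twinClass_of_notMem G ι hu).1 ha).1
    simp [hu, this]

theorem eq_of_rep_eq_of_rank_eq {u v : V} (h1 : rep G ι u = rep G ι v)
    (h2 : rank G ι u = rank G ι v) : u = v := by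
  have key : ∀ a b : V, a ∈ twinClass G ι b → ι a < ι b → rank G ι a < rank G ι b := by
    intro a b hab hlt
    rw [rank, rank, twinClass_eq_of_mem G ι hab]
    refine Finset.card_lt_card (Finset.ssubset_iff_of_subset ?_ |>.2 ⟨a, ?_, ?_⟩)
    · intro x hx
      rw [Finset.mem_filter] at hx ⊢
      exact ⟨hx.1, hx.2.trans hlt⟩
    · exact Finset.mem_filter.2 ⟨hab, hlt⟩
    · simp
  rcases lt_trichotomy (ι u) (ι v) with h | h | h
  · exact absurd h2 (key u v ((rep_eq_rep_iff G hι).1 h1) h).ne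
  · exact hι h
  · exact absurd h2 (key v u ((rep_eq_rep_iff G hι).1 h1.symm) h).ne'

/-- Pigeonhole: `rank` is injective on a class and takes values below its size. -/
theorem exists_rank_eq (v : V) {k : ℕ} (hk : k < (twinClass G ι v).card) :
    ∃ u ∈ twinClass G ι v, rank G ι u = k := by
  classical
  have h := Finset.surj_on_of_inj_on_of_card_le (s := twinClass G ι v)
    (t := Finset.range (twinClass G ι v).card) (fun u _ => rank G ι u)
    (fun u hu => by
      rw [Finset.mem_range, ← twinClass_eq_of_mem G ι hu]
      exact rank_lt G ι u)
    (fun a b ha hb hab => eq_of_rep_eq_of_rank_eq G hι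
      (((rep_eq_rep_iff G hι).2 ha).trans ((rep_eq_rep_iff G hι).2 hb).symm) hab)
    (by simp) k (Finset.mem_range.2 hk)
  obtain ⟨u, hu, h⟩ := h
  exact ⟨u, hu, h.symm⟩

/-- The number of tokens. -/
theorem card_allTokens_le :
    (allTokens G ι).card ≤ ((cover G).card + 2 ^ (cover G).card) * (cover G).card := by
  classical
  -- One vertex per class, the one with the smallest identifier.
  set R := Finset.univ.filter fun v => ι v = rep G ι v with hR
  have hsub : allTokens G ι ⊆ R.biUnion (vertexTokens G ι) := by
    intro t ht
    obtain ⟨v, hv⟩ := (mem_allTokens G ι).1 ht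
    obtain ⟨u, hu, hu'⟩ := exists_rep G ι v
    refine Finset.mem_biUnion.2 ⟨u, ?_, ?_⟩
    · rw [hR, Finset.mem_filter, hu', (rep_eq_rep_iff G hι).2 hu]
      exact ⟨Finset.mem_univ _, rfl⟩
    · rw [mem_vertexTokens] at hv ⊢
      rwa [twinClass_eq_of_mem G ι hu, trace_eq_of_mem_twinClass G ι hu,
        (rep_eq_rep_iff G hι).2 hu]
  have hRcard : R.card ≤ (cover G).card + 2 ^ (cover G).card := by
    have h1 : R ⊆ cover G ∪ R.filter (fun v => v ∉ cover G) := by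
      intro v hv
      by_cases h : v ∈ cover G <;> simp [h, hv]
    refine (Finset.card_le_card h1).trans ((Finset.card_union_le _ _).trans ?_)
    gcongr
    -- Outside the cover a class is determined by its trace, a subset of the cover identifiers.
    have h2 : (R.filter fun v => v ∉ cover G).card ≤ (((cover G).image ι).powerset).card := by
      refine Finset.card_le_card_of_injOn (trace G ι) ?_ ?_
      · intro v _
        rw [Finset.mem_coe, Finset.mem_powerset]
        rw [trace]
        exact Finset.image_subset_image (Finset.filter_subset _ _)
      · intro u hu v hv huv
        rw [Finset.mem_coe, Finset.mem_filter, hR, Finset.mem_filter] at hu hv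
        refine hι ?_
        rw [hu.1.2, hv.1.2]
        exact (rep_eq_rep_iff G hι).2 ((mem_twinClass_of_notMem G ι hv.2).2 ⟨hu.2, huv⟩)
    refine h2.trans ?_
    rw [Finset.card_powerset]
    exact Nat.pow_le_pow_right (by norm_num) Finset.card_image_le
  refine (Finset.card_le_card hsub).trans
    ((Finset.card_biUnion_le_card_mul _ _ (cover G).card ?_).trans ?_)
  · intro v _
    exact Finset.card_image_le.trans (card_trace_le G ι v)
  · gcongr

/-- Every class therefore produces a token. The closed neighbourhood in `trace` is what covers the
case of a cover vertex with no neighbour in the cover. -/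
theorem trace_nonempty (hG : ∀ v, ∃ u, G.Adj v u) (v : V) : (trace G ι v).Nonempty := by
  by_cases hv : v ∈ cover G
  · exact ⟨ι v, (mem_trace_iff G hι).2 ⟨hv, Or.inl rfl⟩⟩
  · obtain ⟨u, hu⟩ := hG v
    exact ⟨ι u, (mem_trace_iff G hι).2 ⟨mem_cover_of_adj hu hv, Or.inr hu.symm⟩⟩

/-- Each cover vertex contributes the token carrying its own identifier. This bounds the cover by a
quantity that the nodes can eventually compute. -/
theorem card_cover_le_card_allTokens : (cover G).card ≤ (allTokens G ι).card := by
  refine Finset.card_le_card_of_injOn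
    (fun v => (rep G ι v, (twinClass G ι v).card, (trace G ι v).card, ι v)) ?_ ?_
  · intro v hv
    exact vertexTokens_subset G ι v ((mem_vertexTokens G ι).2
      ⟨ι v, (mem_trace_iff G hι).2 ⟨hv, Or.inl rfl⟩, rfl⟩)
  · intro u _ v _ huv
    simp only [Prod.mk.injEq] at huv
    exact hι huv.2.2.2

omit hι in
/-- The share of its class that a token accounts for. -/
noncomputable def _root_.ClassToken.share (t : ClassToken) : ℚ := (t.2.1 : ℚ) / t.2.2.1

omit hι in
theorem share_pos {t : ClassToken} (ht : t ∈ allTokens G ι) : 0 < ClassToken.share t := by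
  obtain ⟨v, hv⟩ := (mem_allTokens G ι).1 ht
  obtain ⟨x, hx, rfl⟩ := (mem_vertexTokens G ι).1 hv
  have h1 := card_twinClass_pos G ι v
  have h2 : 0 < (trace G ι v).card := Finset.card_pos.2 ⟨x, hx⟩
  simp only [ClassToken.share]
  positivity

/-- Double counting: each vertex distributes weight 1 equally over its trace. A token collects 1/d
from each of the w members of its class. -/
theorem sum_share_allTokens (hG : ∀ v, ∃ u, G.Adj v u) :
    ∑ t ∈ allTokens G ι, ClassToken.share t = Fintype.card V := by
  classical
  set P : Finset (Σ _ : V, ℕ) := Finset.univ.sigma fun v => trace G ι v with hP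
  set F : (Σ _ : V, ℕ) → ClassToken := fun p =>
    (rep G ι p.1, (twinClass G ι p.1).card, (trace G ι p.1).card, p.2) with hF
  have hmaps : ∀ p ∈ P, F p ∈ allTokens G ι := by
    rintro ⟨v, x⟩ hp
    rw [hP, Finset.mem_sigma] at hp
    exact vertexTokens_subset G ι v ((mem_vertexTokens G ι).2 ⟨x, hp.2, rfl⟩)
  have h1 : ∑ p ∈ P, (1 : ℚ) / (trace G ι p.1).card = Fintype.card V := by
    rw [hP, Finset.sum_sigma]
    have : ∀ v ∈ (Finset.univ : Finset V),
        ∑ _x ∈ trace G ι v, (1 : ℚ) / (trace G ι v).card = 1 := by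
      intro v _
      have := (trace_nonempty G hι hG v).card_pos
      rw [Finset.sum_const, nsmul_eq_mul]
      field_simp
    rw [Finset.sum_congr rfl this]
    simp
  rw [← h1, ← Finset.sum_fiberwise_of_maps_to hmaps]
  refine Finset.sum_congr rfl fun t ht => ?_
  obtain ⟨v, hv⟩ := (mem_allTokens G ι).1 ht
  obtain ⟨x, hx, rfl⟩ := (mem_vertexTokens G ι).1 hv
  have hfib : P.filter (fun p => F p =
      (rep G ι v, (twinClass G ι v).card, (trace G ι v).card, x)) =
      (twinClass G ι v).image fun u => (⟨u, x⟩ : Σ _ : V, ℕ) := by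
    ext ⟨u, y⟩
    simp only [hP, hF, Finset.mem_filter, Finset.mem_sigma, Finset.mem_univ, true_and,
      Prod.mk.injEq, Finset.mem_image, Sigma.mk.injEq, heq_eq_eq]
    constructor
    · rintro ⟨_, h, _, _, rfl⟩
      exact ⟨u, (rep_eq_rep_iff G hι).1 h, rfl, rfl⟩
    · rintro ⟨u', hu', rfl, rfl⟩
      rw [twinClass_eq_of_mem G ι hu', trace_eq_of_mem_twinClass G ι hu',
        (rep_eq_rep_iff G hι).2 hu']
      exact ⟨hx, rfl, rfl, rfl, rfl⟩
  rw [hfib, Finset.sum_image (by intro a _ b _ h; simpa using h)]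
  rw [Finset.sum_congr rfl (g := fun _ => (1 : ℚ) / (trace G ι v).card)
    (fun u hu => by simp only; rw [trace_eq_of_mem_twinClass G ι hu])]
  rw [Finset.sum_const, nsmul_eq_mul, ClassToken.share]
  ring

theorem eq_allTokens_of_sum_share (hG : ∀ v, ∃ u, G.Adj v u) {K : Finset ClassToken}
    (hK : K ⊆ allTokens G ι) (hsum : ∑ t ∈ K, ClassToken.share t = Fintype.card V) :
    K = allTokens G ι := by
  by_contra hne
  obtain ⟨t, ht, htK⟩ := Finset.exists_of_ssubset (lt_of_le_of_ne hK hne)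
  have h := Finset.sum_lt_sum_of_subset hK ht htK (share_pos G ht)
    (fun s hs _ => (share_pos G hs).le)
  rw [hsum, sum_share_allTokens G hι hG] at h
  exact lt_irrefl _ h

end Classes

/-! ### Rebuilding the graph from the tokens -/

/-- Labels of vertices: representative of the class, and position in the class. -/
def labels (K : Finset ClassToken) : Set (ℕ × ℕ) := {l | ∃ w d x, (l.1, w, d, x) ∈ K ∧ l.2 < w}

theorem finite_labels (K : Finset ClassToken) : (labels K).Finite := by
  refine (K.finite_toSet.biUnion (t := fun t => (fun k => (t.1, k)) '' Set.Iio t.2.1)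
    fun t _ => (Set.finite_Iio _).image _).subset ?_
  rintro ⟨r, k⟩ ⟨w, d, x, h, hk⟩
  exact Set.mem_biUnion h ⟨k, hk, rfl⟩

/-- The graph on labels that is described by a set of tokens. -/
def labelGraph (K : Finset ClassToken) : SimpleGraph (labels K) where
  Adj a b := a ≠ b ∧ ((∃ w d, (a.1.1, w, d, b.1.1) ∈ K) ∨ ∃ w d, (b.1.1, w, d, a.1.1) ∈ K)
  symm := ⟨fun _ _ h => ⟨h.1.symm, h.2.symm⟩⟩
  loopless := ⟨fun _ h => h.1 rfl⟩

section Rebuild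

variable {V : Type} [Fintype V] (G : SimpleGraph V) [DecidableRel G.Adj] {ι : V → ℕ}
  (hι : Function.Injective ι) (hG : ∀ v, ∃ u, G.Adj v u)
include hι

theorem token_mem_iff {v : V} {x : ℕ} :
    (∃ w d, (rep G ι v, w, d, x) ∈ allTokens G ι) ↔ x ∈ trace G ι v := by
  constructor
  · rintro ⟨w, d, h⟩
    obtain ⟨u, hu⟩ := (mem_allTokens G ι).1 h
    obtain ⟨y, hy, he⟩ := (mem_vertexTokens G ι).1 hu
    simp only [Prod.mk.injEq] at he
    obtain ⟨h1, -, -, rfl⟩ := he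
    rwa [← trace_eq_of_mem_twinClass G ι ((rep_eq_rep_iff G hι).1 h1)]
  · intro hx
    exact ⟨_, _, vertexTokens_subset G ι v ((mem_vertexTokens G ι).2 ⟨x, hx, rfl⟩)⟩

include hG

theorem label_mem (v : V) : (rep G ι v, rank G ι v) ∈ labels (allTokens G ι) := by
  obtain ⟨x, hx⟩ := trace_nonempty G hι hG v
  exact ⟨_, _, x, vertexTokens_subset G ι v ((mem_vertexTokens G ι).2 ⟨x, hx, rfl⟩), rank_lt G ι v⟩

/-- The graph described by the tokens is the original one. -/
noncomputable def labelIso : G ≃g labelGraph (allTokens G ι) where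
  toEquiv := Equiv.ofBijective
    (fun v => (⟨(rep G ι v, rank G ι v), label_mem G hι hG v⟩ : labels (allTokens G ι))) <| by
      constructor
      · intro u v huv
        have := congrArg Subtype.val huv
        simp only [Prod.mk.injEq] at this
        exact eq_of_rep_eq_of_rank_eq G hι this.1 this.2
      · rintro ⟨⟨r, k⟩, w, d, x, ht, hk⟩
        obtain ⟨v, hv⟩ := (mem_allTokens G ι).1 ht
        obtain ⟨y, hy, he⟩ := (mem_vertexTokens G ι).1 hv
        simp only [Prod.mk.injEq] at he
        obtain ⟨h1, h2, -, -⟩ := he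
        simp only at hk
        obtain ⟨u, hu, hu'⟩ := exists_rank_eq G hι v (h2 ▸ hk)
        refine ⟨u, Subtype.ext ?_⟩
        simp only [Prod.mk.injEq]
        exact ⟨((rep_eq_rep_iff G hι).2 hu).trans h1, hu'⟩
  map_rel_iff' := by
    intro u v
    have hne : (⟨(rep G ι u, rank G ι u), label_mem G hι hG u⟩ : labels (allTokens G ι)) ≠
        ⟨(rep G ι v, rank G ι v), label_mem G hι hG v⟩ ↔ u ≠ v := by
      refine not_congr ⟨fun h => ?_, fun h => by subst h; rfl⟩
      have := congrArg Subtype.val h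
      simp only [Prod.mk.injEq] at this
      exact eq_of_rep_eq_of_rank_eq G hι this.1 this.2
    change (_ ≠ _ ∧ ((∃ w d, (rep G ι u, w, d, rep G ι v) ∈ allTokens G ι) ∨
      ∃ w d, (rep G ι v, w, d, rep G ι u) ∈ allTokens G ι)) ↔ _
    rw [token_mem_iff G hι, token_mem_iff G hι, mem_trace_rep_iff G hι, mem_trace_rep_iff G hι]
    refine (and_congr_left' hne).trans ?_
    constructor
    · rintro ⟨hne, ⟨_, rfl | h⟩ | ⟨_, rfl | h⟩⟩
      · exact absurd rfl hne
      · exact h.symm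
      · exact absurd rfl hne
      · exact h
    -- A token must record the edge at one of its ends: if `u` is in the cover its identifier occurs
    -- in the trace of `v`, otherwise `v` is in the cover and the roles are exchanged.
    · intro h
      refine ⟨h.ne, ?_⟩
      by_cases hu : u ∈ cover G
      · exact Or.inr ⟨hu, Or.inr h⟩
      · exact Or.inl ⟨mem_cover_of_adj h hu, Or.inr h.symm⟩

end Rebuild

end DegreeCover

/-! ### Messages and their encoding -/

/-- What a node sends in one round. -/
structure FloodMessage where
  ident : ℕ
  deg : ℕ
  inCover : ℕ
  item : ℕ
  rep : ℕ
  rank : ℕ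
  tok : Option ClassToken

namespace FloodMessage

instance : Inhabited FloodMessage := ⟨⟨0, 0, 0, 0, 0, 0, none⟩⟩

def encodeToken : Option ClassToken → ℕ
  | none => 0
  | some (r, w, d, x) => Nat.pair (Nat.pair r w) (Nat.pair d x) + 1

def decodeToken : ℕ → Option ClassToken
  | 0 => none
  | k + 1 => some ((k.unpair.1).unpair.1, (k.unpair.1).unpair.2, (k.unpair.2).unpair.1,
      (k.unpair.2).unpair.2)

theorem decode_encodeToken (t : Option ClassToken) : decodeToken (encodeToken t) = t := by
  rcases t with _ | ⟨r, w, d, x⟩ <;> simp [encodeToken, decodeToken]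

def encode (m : FloodMessage) : ℕ :=
  Nat.pair (Nat.pair (Nat.pair m.ident m.deg) (Nat.pair m.inCover m.item))
    (Nat.pair (Nat.pair m.rep m.rank) (encodeToken m.tok))

def decode (k : ℕ) : FloodMessage where
  ident := k.unpair.1.unpair.1.unpair.1
  deg := k.unpair.1.unpair.1.unpair.2
  inCover := k.unpair.1.unpair.2.unpair.1
  item := k.unpair.1.unpair.2.unpair.2
  rep := k.unpair.2.unpair.1.unpair.1
  rank := k.unpair.2.unpair.1.unpair.2
  tok := decodeToken k.unpair.2.unpair.2

theorem decode_encode (m : FloodMessage) : decode (encode m) = m := by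
  simp [decode, encode, decode_encodeToken]

/-- All numbers in the message are smaller than `B`. -/
def Bounded (B : ℕ) (m : FloodMessage) : Prop :=
  m.ident < B ∧ m.deg < B ∧ m.inCover < B ∧ m.item < B ∧ m.rep < B ∧ m.rank < B ∧
    ∀ t ∈ m.tok, t.1 < B ∧ t.2.1 < B ∧ t.2.2.1 < B ∧ t.2.2.2 < B

theorem _root_.Nat.pair_lt_sq {a b B : ℕ} (ha : a < B) (hb : b < B) : Nat.pair a b < B ^ 2 :=
  (Nat.pair_lt_max_add_one_sq a b).trans_le
    (Nat.pow_le_pow_left (Nat.succ_le_of_lt (max_lt ha hb)) 2)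

/-- Each level of pairing squares the bound. The exponents are rounded up so that both halves of
every pair share one bound. -/
theorem encode_lt {B : ℕ} (hB : 2 ≤ B) {m : FloodMessage} (h : m.Bounded B) :
    m.encode < B ^ 32 := by
  obtain ⟨h1, h2, h3, h4, h5, h6, h7⟩ := h
  have ht : encodeToken m.tok < B ^ 8 := by
    rcases htok : m.tok with _ | ⟨r, w, d, x⟩
    · exact Nat.pow_pos (by omega)
    · obtain ⟨a1, a2, a3, a4⟩ := h7 _ htok
      have := Nat.pair_lt_sq (Nat.pair_lt_sq a1 a2) (Nat.pair_lt_sq a3 a4)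
      calc encodeToken (some (r, w, d, x)) ≤ (B ^ 2) ^ 2 := this
        _ = B ^ 4 := by ring
        _ < B ^ 8 := Nat.pow_lt_pow_right hB (by norm_num)
  have hr : Nat.pair m.rep m.rank < B ^ 8 :=
    (Nat.pair_lt_sq h5 h6).trans_le (Nat.pow_le_pow_right (by omega) (by norm_num))
  have hl : Nat.pair (Nat.pair m.ident m.deg) (Nat.pair m.inCover m.item) < B ^ 16 := by
    have := Nat.pair_lt_sq (Nat.pair_lt_sq h1 h2) (Nat.pair_lt_sq h3 h4)
    calc _ < (B ^ 2) ^ 2 := this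
      _ = B ^ 4 := by ring
      _ ≤ B ^ 16 := Nat.pow_le_pow_right (by omega) (by norm_num)
  calc m.encode < (B ^ 16) ^ 2 :=
        Nat.pair_lt_sq hl ((Nat.pair_lt_sq hr ht).trans_eq (by ring))
    _ = B ^ 32 := by ring

end FloodMessage

/-! ### The program -/

/-- Local state: the history of received messages (by round and port), and the tokens that are
known and those that have already been sent. -/
structure FloodState where
  num : ℕ
  ident : ℕ
  deg : ℕ
  time : ℕ
  hist : ℕ → ℕ → FloodMessage
  known : Finset ClassToken
  sent : Finset ClassToken

namespace FloodState

variable (s : FloodState)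

/-- Identifier of the neighbour at a port. -/
def nbrIdent (i : ℕ) : ℕ := (s.hist 0 i).ident

/-- Degree of the neighbour at a port. -/
def nbrDeg (i : ℕ) : ℕ := (s.hist 0 i).deg

def InCover : Prop := ∃ i < s.deg, s.nbrDeg i ≤ s.deg

/-- Round 1 is the first in which this flag is reliable, since the sender needs the degrees received
in round 0. -/
def NbrInCover (i : ℕ) : Prop := (s.hist 1 i).inCover = 1

/-- Identifiers of the neighbours of the neighbour at a port. -/
def nbrTrace (i : ℕ) : Finset ℕ := (Finset.range (s.nbrDeg i)).image fun j => (s.hist (1 + j) i).item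

/-- The neighbours outside the cover have transmitted all their neighbours. -/
def Ready : Prop := 2 ≤ s.time ∧ ∀ i < s.deg, ¬ s.NbrInCover i → s.nbrDeg i + 1 ≤ s.time

open scoped Classical in
/-- Ports leading to the class of the neighbour at a port. -/
noncomputable def nbrClass (i : ℕ) : Finset ℕ :=
  (Finset.range s.deg).filter fun j => ¬ s.NbrInCover j ∧ s.nbrTrace j = s.nbrTrace i

noncomputable def nbrRep (i : ℕ) : ℕ := sInf (s.nbrIdent '' (s.nbrClass i : Set ℕ))

noncomputable def nbrRank (i : ℕ) : ℕ :=
  ((s.nbrClass i).filter fun j => s.nbrIdent j < s.nbrIdent i).card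

-- Meaningful only at a cover node, as the node's own identifier is inserted unconditionally.
open scoped Classical in
noncomputable def selfTrace : Finset ℕ :=
  insert s.ident (((Finset.range s.deg).filter s.NbrInCover).image s.nbrIdent)

open scoped Classical in
/-- The tokens that the node can form from what it has heard from its neighbours. -/
noncomputable def ownTokens : Finset ClassToken :=
  if s.Ready then
    (if s.InCover then s.selfTrace.image fun x => (s.ident, 1, s.selfTrace.card, x) else ∅) ∪
      ((Finset.range s.deg).filter fun i => ¬ s.NbrInCover i).biUnion fun i =>
        (s.nbrTrace i).image fun x => (s.nbrRep i, (s.nbrClass i).card, (s.nbrTrace i).card, x)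
  else ∅

open scoped Classical in
/-- A token that is to be sent. -/
noncomputable def pending : Option ClassToken :=
  if h : (s.known \ s.sent).Nonempty then some h.choose else none

open scoped Classical in
noncomputable def message (i : ℕ) : FloodMessage where
  ident := s.ident
  deg := s.deg
  inCover := if s.InCover then 1 else 0
  -- In round 1 + j the neighbour at port j is announced; the value sent in round 0 is a dummy.
  item := s.nbrIdent (s.time - 1)
  rep := if s.Ready ∧ ¬ s.NbrInCover i then s.nbrRep i else 0
  rank := if s.Ready ∧ ¬ s.NbrInCover i then s.nbrRank i else 0
  tok := s.pending

/-- One more round of history. -/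
def record (inb : ℕ → FloodMessage) : FloodState :=
  { s with time := s.time + 1, hist := Function.update s.hist s.time inb }

open scoped Classical in
noncomputable def receive (inb : ℕ → FloodMessage) : FloodState :=
  { s.record inb with
    known := s.known ∪ ((Finset.range s.deg).biUnion fun i => (inb i).tok.toFinset) ∪
      (s.record inb).ownTokens
    sent := s.sent ∪ s.pending.toFinset }

def start (n a d : ℕ) : FloodState := ⟨n, a, d, 0, fun _ _ => default, ∅, ∅⟩

open scoped Classical in
/-- The label of the node. -/
noncomputable def label : ℕ × ℕ :=
  if s.InCover then (s.ident, 0) else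
    -- Outside the cover every port, in particular port 0, leads to a cover node, which is adjacent
    -- to the whole class and can compute the label.
    ((s.hist (s.time - 1) 0).rep, (s.hist (s.time - 1) 0).rank)

/-- The time at which all nodes stop, from the number of tokens. -/
def stopTime (N : ℕ) : ℕ := 10 * (N + 1) ^ 2

/-- The node knows everything, and so do all others. -/
def Finished : Prop :=
  ∑ t ∈ s.known, ClassToken.share t = s.num ∧ stopTime s.known.card ≤ s.time

end FloodState

open DegreeCover in
/-- A solution chosen for the graph described by a set of tokens. -/
noncomputable def chosenSolution (K : Finset ClassToken) {m : ℕ} (H : SimpleGraph (Fin m)) :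
    labels K → Option (Fin m) :=
  haveI := (finite_labels K).to_subtype
  (exists_isMaximumCommonInducedSubgraph (labelGraph K) H).choose

/-- A solution chosen for the graph with one vertex. -/
noncomputable def trivialSolution {m : ℕ} (H : SimpleGraph (Fin m)) : Unit → Option (Fin m) :=
  (exists_isMaximumCommonInducedSubgraph (⊥ : SimpleGraph Unit) H).choose

open scoped Classical in
/-- The program. -/
noncomputable def floodAlgorithm (m : ℕ) (H : SimpleGraph (Fin m)) :
    CongestAlgorithm (Option (Fin m)) where
  State := FloodState
  init := FloodState.start
  send s i := some (s.message i).encode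
  receive s inb := s.receive fun i => ((inb i).map FloodMessage.decode).getD default
  output s :=
    -- A single vertex has no token, so the weights could never sum to n.
    if s.num = 1 then some (trivialSolution H ())
    else if s.Finished then
      some (if h : s.label ∈ DegreeCover.labels s.known then chosenSolution s.known H ⟨_, h⟩
        else none)
    else none

/-! ### Analysis of the run without stopping -/

namespace CongestNetwork

open DegreeCover FloodState

variable {V : Type} [Fintype V] {G : SimpleGraph V} [DecidableRel G.Adj] {c : ℕ}
  (N : CongestNetwork G c)

/-- The neighbour at a port. -/
def nbr (v : V) (i : Fin (G.degree v)) : V := N.port v i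

theorem adj_nbr (v : V) (i : Fin (G.degree v)) : G.Adj v (N.nbr v i) := (N.port v i).2

theorem nbr_injective (v : V) : Function.Injective (N.nbr v) :=
  Subtype.val_injective.comp (N.port v).injective

theorem exists_nbr_eq {v u : V} (h : G.Adj v u) : ∃ i, N.nbr v i = u :=
  ⟨(N.port v).symm ⟨u, h⟩, by simp [nbr]⟩

/-- The port at the other end of an edge. -/
def backPort (v : V) (i : Fin (G.degree v)) : Fin (G.degree (N.nbr v i)) :=
  (N.port (N.nbr v i)).symm ⟨v, (N.adj_nbr v i).symm⟩

theorem nbr_backPort (v : V) (i : Fin (G.degree v)) : N.nbr (N.nbr v i) (N.backPort v i) = v := by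
  rw [nbr, backPort, Equiv.apply_symm_apply]

/-- The messages that `v` receives when the states are `s`. -/
noncomputable def received (s : V → FloodState) (v : V) (i : ℕ) : FloodMessage :=
  if h : i < G.degree v then (s (N.nbr v ⟨i, h⟩)).message (N.backPort v ⟨i, h⟩) else default

/-- The states when nobody stops. -/
noncomputable def run : ℕ → V → FloodState
  | 0, v => start (Fintype.card V) (N.ident v) (G.degree v)
  | t + 1, v => (run t v).receive (N.received (run t) v)

theorem received_fin (s : V → FloodState) (v : V) (i : Fin (G.degree v)) :
    N.received s v i = (s (N.nbr v i)).message (N.backPort v i) := by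
  simp [received]

theorem num_run (t : ℕ) (v : V) : (N.run t v).num = Fintype.card V := by
  induction t with
  | zero => rfl
  | succ t ih => exact ih

theorem ident_run (t : ℕ) (v : V) : (N.run t v).ident = N.ident v := by
  induction t with
  | zero => rfl
  | succ t ih => exact ih

theorem deg_run (t : ℕ) (v : V) : (N.run t v).deg = G.degree v := by
  induction t with
  | zero => rfl
  | succ t ih => exact ih

theorem time_run (t : ℕ) (v : V) : (N.run t v).time = t := by
  induction t with
  | zero => rfl
  | succ t ih => exact congrArg (· + 1) ih

theorem hist_run_succ (t : ℕ) (v : V) : (N.run (t + 1) v).hist =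
    Function.update (N.run t v).hist t (N.received (N.run t) v) := by
  conv_rhs => rw [← N.time_run t v]
  rw [N.time_run t v]
  change Function.update (N.run t v).hist (N.run t v).time _ = _
  rw [N.time_run t v]

theorem hist_run {r t : ℕ} (h : r < t) (v : V) :
    (N.run t v).hist r = N.received (N.run r) v := by
  induction t with
  | zero => omega
  | succ t ih =>
    rw [hist_run_succ]
    rcases Nat.lt_succ_iff_lt_or_eq.1 h with h | rfl
    · rw [Function.update_of_ne h.ne, ih h]
    · rw [Function.update_self]

theorem hist_run_fin {r t : ℕ} (h : r < t) (v : V) (i : Fin (G.degree v)) :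
    (N.run t v).hist r i = (N.run r (N.nbr v i)).message (N.backPort v i) := by
  rw [N.hist_run h, received_fin]

theorem nbrIdent_run {t : ℕ} (ht : 1 ≤ t) (v : V) (i : Fin (G.degree v)) :
    (N.run t v).nbrIdent i = N.ident (N.nbr v i) := by
  rw [nbrIdent, N.hist_run_fin ht]
  exact N.ident_run _ _

theorem nbrDeg_run {t : ℕ} (ht : 1 ≤ t) (v : V) (i : Fin (G.degree v)) :
    (N.run t v).nbrDeg i = G.degree (N.nbr v i) := by
  rw [nbrDeg, N.hist_run_fin ht]
  exact N.deg_run _ _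

theorem inCover_run {t : ℕ} (ht : 1 ≤ t) (v : V) : (N.run t v).InCover ↔ v ∈ cover G := by
  rw [InCover, mem_cover, N.deg_run]
  constructor
  · rintro ⟨i, hi, h⟩
    have := N.nbrDeg_run ht v ⟨i, hi⟩
    exact ⟨_, N.adj_nbr v ⟨i, hi⟩, this ▸ h⟩
  · rintro ⟨u, hu, h⟩
    obtain ⟨i, rfl⟩ := N.exists_nbr_eq hu
    exact ⟨i, i.2, by rwa [N.nbrDeg_run ht]⟩

theorem nbrInCover_run {t : ℕ} (ht : 2 ≤ t) (v : V) (i : Fin (G.degree v)) :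
    (N.run t v).NbrInCover i ↔ N.nbr v i ∈ cover G := by
  rw [NbrInCover, N.hist_run_fin ht, ← N.inCover_run le_rfl (N.nbr v i)]
  simp [message]

theorem nbrTrace_run {t : ℕ} (v : V) (i : Fin (G.degree v)) (hi : N.nbr v i ∉ cover G)
    (ht : G.degree (N.nbr v i) + 1 ≤ t) :
    (N.run t v).nbrTrace i = trace G N.ident (N.nbr v i) := by
  rw [nbrTrace, N.nbrDeg_run (by omega), trace_of_notMem G hi]
  have key : ∀ j : Fin (G.degree (N.nbr v i)),
      ((N.run t v).hist (1 + j) i).item = N.ident (N.nbr (N.nbr v i) j) := by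
    intro j
    rw [N.hist_run_fin (by omega)]
    simp only [message]
    rw [N.time_run, Nat.add_sub_cancel_left, N.nbrIdent_run (by omega)]
  ext x
  simp only [Finset.mem_image, Finset.mem_range, SimpleGraph.mem_neighborFinset]
  constructor
  · rintro ⟨j, hj, rfl⟩
    exact ⟨_, N.adj_nbr _ ⟨j, hj⟩, (key ⟨j, hj⟩).symm⟩
  · rintro ⟨w, hw, rfl⟩
    obtain ⟨j, rfl⟩ := N.exists_nbr_eq hw
    exact ⟨j, j.2, key j⟩

/-- A vertex outside the cover has all its neighbours in the cover, so announcing them takes at most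
|cover| rounds after round 0. -/
theorem ready_run {t : ℕ} (ht : (cover G).card + 2 ≤ t) (v : V) : (N.run t v).Ready := by
  refine ⟨by rw [time_run]; omega, fun i hi h => ?_⟩
  rw [deg_run] at hi
  have h1 := N.nbrInCover_run (by omega : 2 ≤ t) v ⟨i, hi⟩
  have h2 := N.nbrDeg_run (by omega : 1 ≤ t) v ⟨i, hi⟩
  have h3 := degree_le_of_notMem G (mt h1.2 h)
  simp only at h2
  rw [time_run, h2]
  omega

/-! ### Correctness of the data computed by a ready node -/

section Ready

variable {N} {t : ℕ} {v : V} (hr : (N.run t v).Ready)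
include hr

theorem two_le_of_ready : 2 ≤ t := by
  have := hr.1
  rwa [time_run] at this

theorem nbrTrace_of_ready (i : Fin (G.degree v)) (hi : N.nbr v i ∉ cover G) :
    (N.run t v).nbrTrace i = trace G N.ident (N.nbr v i) := by
  have h2 := two_le_of_ready hr
  refine N.nbrTrace_run v i hi ?_
  have := hr.2 i (by rw [deg_run]; exact i.2) (by rwa [N.nbrInCover_run h2])
  rwa [N.nbrDeg_run (by omega), time_run] at this

open scoped Classical in
theorem nbrClass_of_ready (i : Fin (G.degree v)) (hi : N.nbr v i ∉ cover G) :
    ∃ F : Finset (Fin (G.degree v)), (N.run t v).nbrClass i = F.map Fin.valEmbedding ∧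
      twinClass G N.ident (N.nbr v i) = F.map ⟨N.nbr v, N.nbr_injective v⟩ := by
  have h2 := two_le_of_ready hr
  refine ⟨Finset.univ.filter fun j => N.nbr v j ∈ twinClass G N.ident (N.nbr v i), ?_, ?_⟩
  · ext j
    simp only [nbrClass, Finset.mem_filter, Finset.mem_range, Finset.mem_map, Finset.mem_univ,
      true_and, Fin.valEmbedding_apply, deg_run]
    have key : ∀ j : Fin (G.degree v), (¬ (N.run t v).NbrInCover j ∧
        (N.run t v).nbrTrace j = (N.run t v).nbrTrace i) ↔
        N.nbr v j ∈ twinClass G N.ident (N.nbr v i) := by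
      intro j
      rw [mem_twinClass_of_notMem G _ hi, N.nbrInCover_run h2, nbrTrace_of_ready hr i hi]
      refine and_congr_right fun hj => ?_
      rw [nbrTrace_of_ready hr j hj]
    constructor
    · rintro ⟨hj, h⟩
      exact ⟨⟨j, hj⟩, (key ⟨j, hj⟩).1 h, rfl⟩
    · rintro ⟨j, h, rfl⟩
      exact ⟨j.2, (key j).2 h⟩
  · ext u
    simp only [Finset.mem_map, Finset.mem_filter, Finset.mem_univ, true_and,
      Function.Embedding.coeFn_mk]
    constructor
    · intro hu
      -- The cover vertex `v` lies in the common trace of the class, so every twin is a neighbour of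
      -- `v` and the class is entirely visible from it.
      have hv : v ∈ cover G := mem_cover_of_adj (N.adj_nbr v i).symm hi
      have h1 : N.ident v ∈ trace G N.ident u := by
        rw [trace_eq_of_mem_twinClass G _ hu, mem_trace_iff G N.ident_injective]
        exact ⟨hv, Or.inr (N.adj_nbr v i)⟩
      have h3 := ((mem_twinClass_of_notMem G _ hi).1 hu).1
      rcases ((mem_trace_iff G N.ident_injective).1 h1).2 with rfl | h
      · exact absurd hv h3
      · obtain ⟨j, rfl⟩ := N.exists_nbr_eq h
        exact ⟨j, hu, rfl⟩
    · rintro ⟨j, hj, rfl⟩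
      exact hj

theorem card_nbrClass_of_ready (i : Fin (G.degree v)) (hi : N.nbr v i ∉ cover G) :
    ((N.run t v).nbrClass i).card = (twinClass G N.ident (N.nbr v i)).card := by
  obtain ⟨F, h1, h2⟩ := nbrClass_of_ready hr i hi
  rw [h1, h2, Finset.card_map, Finset.card_map]

theorem nbrRep_of_ready (i : Fin (G.degree v)) (hi : N.nbr v i ∉ cover G) :
    (N.run t v).nbrRep i = DegreeCover.rep G N.ident (N.nbr v i) := by
  have h := two_le_of_ready hr
  obtain ⟨F, h1, h2⟩ := nbrClass_of_ready hr i hi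
  rw [nbrRep, DegreeCover.rep, h1, h2]
  congr 1
  ext x
  simp [N.nbrIdent_run (show 1 ≤ t by omega)]

theorem nbrRank_of_ready (i : Fin (G.degree v)) (hi : N.nbr v i ∉ cover G) :
    (N.run t v).nbrRank i = DegreeCover.rank G N.ident (N.nbr v i) := by
  have h := two_le_of_ready hr
  obtain ⟨F, h1, h2⟩ := nbrClass_of_ready hr i hi
  rw [nbrRank, DegreeCover.rank, h1, h2, Finset.filter_map, Finset.filter_map, Finset.card_map,
    Finset.card_map]
  congr 1
  ext j
  simp [N.nbrIdent_run (show 1 ≤ t by omega)]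

theorem selfTrace_of_ready (hv : v ∈ cover G) :
    (N.run t v).selfTrace = trace G N.ident v := by
  have h2 := two_le_of_ready hr
  ext x
  simp only [selfTrace, Finset.mem_insert, Finset.mem_image, Finset.mem_filter, Finset.mem_range,
    mem_trace, ident_run, deg_run]
  constructor
  · rintro (rfl | ⟨i, ⟨hi, h⟩, rfl⟩)
    · exact ⟨v, hv, Or.inl rfl, rfl⟩
    · exact ⟨N.nbr v ⟨i, hi⟩, (N.nbrInCover_run h2 v ⟨i, hi⟩).1 h, Or.inr (N.adj_nbr v _).symm,
        (N.nbrIdent_run (by omega) v ⟨i, hi⟩).symm⟩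
  · rintro ⟨u, hu, rfl | h, rfl⟩
    · exact Or.inl rfl
    · obtain ⟨i, rfl⟩ := N.exists_nbr_eq h.symm
      exact Or.inr ⟨i, ⟨i.2, (N.nbrInCover_run h2 v i).2 hu⟩, N.nbrIdent_run (by omega) v i⟩

theorem mem_ownTokens_of_ready {x : ClassToken} : x ∈ (N.run t v).ownTokens ↔
    (v ∈ cover G ∧ x ∈ vertexTokens G N.ident v) ∨
      ∃ u, G.Adj v u ∧ u ∉ cover G ∧ x ∈ vertexTokens G N.ident u := by
  have h2 := two_le_of_ready hr
  rw [ownTokens, if_pos hr, Finset.mem_union]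
  refine or_congr ?_ ?_
  · by_cases hv : v ∈ cover G
    · rw [if_pos ((N.inCover_run (by omega) v).2 hv), selfTrace_of_ready hr hv, ident_run,
        mem_vertexTokens, rep_of_mem G _ hv, twinClass_of_mem G _ hv]
      simp [hv]
    · rw [if_neg (mt (N.inCover_run (by omega) v).1 hv)]
      simp [hv]
  · have key : ∀ i : Fin (G.degree v), N.nbr v i ∉ cover G →
        ((N.run t v).nbrTrace i).image (fun x => ((N.run t v).nbrRep i,
          ((N.run t v).nbrClass i).card, ((N.run t v).nbrTrace i).card, x)) =
        vertexTokens G N.ident (N.nbr v i) := by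
      intro i hi
      rw [vertexTokens, nbrTrace_of_ready hr i hi, nbrRep_of_ready hr i hi,
        card_nbrClass_of_ready hr i hi]
    simp only [Finset.mem_biUnion, Finset.mem_filter, Finset.mem_range, deg_run]
    constructor
    · rintro ⟨i, ⟨hi, h⟩, hx⟩
      have h' := mt (N.nbrInCover_run h2 v ⟨i, hi⟩).2 h
      refine ⟨N.nbr v ⟨i, hi⟩, N.adj_nbr v _, h', ?_⟩
      rw [← key ⟨i, hi⟩ h']
      exact hx
    · rintro ⟨u, hu, hu', hx⟩
      obtain ⟨i, rfl⟩ := N.exists_nbr_eq hu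
      refine ⟨i, ⟨i.2, mt (N.nbrInCover_run h2 v i).1 hu'⟩, ?_⟩
      rw [← key i hu'] at hx
      exact hx

end Ready

/-! ### Flooding of the tokens -/

theorem ownTokens_subset (t : ℕ) (v : V) : (N.run t v).ownTokens ⊆ allTokens G N.ident := by
  intro x hx
  by_cases hr : (N.run t v).Ready
  · rcases (mem_ownTokens_of_ready hr).1 hx with ⟨-, h⟩ | ⟨u, -, -, h⟩
    · exact vertexTokens_subset G _ v h
    · exact vertexTokens_subset G _ u h
  · rw [ownTokens, if_neg hr] at hx
    simp at hx

open scoped Classical in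
theorem known_run_succ (t : ℕ) (v : V) : (N.run (t + 1) v).known = (N.run t v).known ∪
    ((Finset.range (N.run t v).deg).biUnion fun i => (N.received (N.run t) v i).tok.toFinset) ∪
      (N.run (t + 1) v).ownTokens := rfl

open scoped Classical in
theorem sent_run_succ (t : ℕ) (v : V) :
    (N.run (t + 1) v).sent = (N.run t v).sent ∪ (N.run t v).pending.toFinset := rfl

theorem _root_.FloodState.mem_of_pending {s : FloodState} {x : ClassToken}
    (h : s.pending = some x) : x ∈ s.known ∧ x ∉ s.sent := by
  classical
  rw [pending] at h
  split_ifs at h with h'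
  have := h'.choose_spec
  rw [Option.some.inj h, Finset.mem_sdiff] at this
  exact this

theorem _root_.FloodState.exists_pending {s : FloodState} {x : ClassToken}
    (h : x ∈ s.known) (h' : x ∉ s.sent) : ∃ y, s.pending = some y := by
  classical
  rw [pending, dif_pos ⟨x, Finset.mem_sdiff.2 ⟨h, h'⟩⟩]
  exact ⟨_, rfl⟩

theorem mem_known_run_succ {t : ℕ} {v : V} {x : ClassToken} : x ∈ (N.run (t + 1) v).known ↔
    x ∈ (N.run t v).known ∨ (∃ u, G.Adj v u ∧ (N.run t u).pending = some x) ∨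
      x ∈ (N.run (t + 1) v).ownTokens := by
  classical
  rw [known_run_succ, Finset.mem_union, Finset.mem_union, or_assoc]
  refine or_congr_right (or_congr_left ?_)
  simp only [Finset.mem_biUnion, Finset.mem_range, deg_run, Option.mem_toFinset, Option.mem_def]
  constructor
  · rintro ⟨i, hi, h⟩
    rw [N.received_fin _ v ⟨i, hi⟩] at h
    exact ⟨_, N.adj_nbr v ⟨i, hi⟩, h⟩
  · rintro ⟨u, hu, h⟩
    obtain ⟨i, rfl⟩ := N.exists_nbr_eq hu
    refine ⟨i, i.2, ?_⟩
    rw [N.received_fin _ v i]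
    exact h

theorem known_run_mono {t t' : ℕ} (h : t ≤ t') (v : V) :
    (N.run t v).known ⊆ (N.run t' v).known := by
  induction h with
  | refl => exact subset_rfl
  | step _ ih => exact ih.trans fun x hx => N.mem_known_run_succ.2 (Or.inl hx)

theorem known_run_subset (t : ℕ) (v : V) : (N.run t v).known ⊆ allTokens G N.ident := by
  induction t generalizing v with
  | zero => exact Finset.empty_subset _
  | succ t ih =>
    intro x hx
    rcases N.mem_known_run_succ.1 hx with h | ⟨u, -, h⟩ | h
    · exact ih v h
    · exact ih u (mem_of_pending h).1
    · exact N.ownTokens_subset _ _ h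

theorem sent_run_subset_known (t : ℕ) {u v : V} (h : u = v ∨ G.Adj v u) :
    (N.run t u).sent ⊆ (N.run t v).known := by
  classical
  induction t with
  | zero => exact Finset.empty_subset _
  | succ t ih =>
    intro x hx
    rw [sent_run_succ, Finset.mem_union, Option.mem_toFinset, Option.mem_def] at hx
    rw [mem_known_run_succ]
    rcases hx with hx | hx
    · exact Or.inl (ih hx)
    · rcases h with rfl | h
      · exact Or.inl (mem_of_pending hx).1
      · exact Or.inr (Or.inl ⟨u, h, hx⟩)

theorem mem_sent_of_mem_known {t : ℕ} {v : V} {x : ClassToken} (hx : x ∈ (N.run t v).known) :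
    x ∈ (N.run (t + ((allTokens G N.ident).card + 1)) v).sent := by
  classical
  -- While `x` is unsent something is pending, so the sent set gains a new element in every round;
  -- it cannot outgrow the set of all tokens.
  have key : ∀ s, x ∈ (N.run (t + s) v).sent ∨ s ≤ (N.run (t + s) v).sent.card := by
    intro s
    induction s with
    | zero => exact Or.inr (Nat.zero_le _)
    | succ s ih =>
      rw [← add_assoc, sent_run_succ]
      by_cases h : x ∈ (N.run (t + s) v).sent
      · exact Or.inl (Finset.mem_union_left _ h)
      · obtain ⟨y, hy⟩ := exists_pending (N.known_run_mono (Nat.le_add_right t s) v hx) h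
        have hy' := (mem_of_pending hy).2
        refine Or.inr ?_
        rw [hy, Option.toFinset_some, Finset.union_singleton, Finset.card_insert_of_notMem hy']
        have := ih.resolve_left h
        omega
  refine (key _).resolve_right fun h => ?_
  have h1 := Finset.card_le_card ((N.sent_run_subset_known _ (Or.inl rfl)).trans
    (N.known_run_subset (t + ((allTokens G N.ident).card + 1)) v))
  omega

/-- Each edge costs at most one round per token, plus one: by then the sender has sent `x`. -/
theorem mem_known_of_walk {u v : V} (p : G.Walk u v) {t : ℕ} {x : ClassToken}
    (hx : x ∈ (N.run t u).known) :
    x ∈ (N.run (t + p.length * ((allTokens G N.ident).card + 1)) v).known := by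
  induction p generalizing t with
  | nil => simpa using hx
  | cons h p ih =>
    have h1 := N.sent_run_subset_known _ (Or.inr h.symm) (N.mem_sent_of_mem_known hx)
    have h2 := ih h1
    rw [SimpleGraph.Walk.length_cons]
    convert h2 using 3
    ring

theorem _root_.SimpleGraph.Connected.exists_adj_of_two_le_card {V : Type} [Fintype V]
    {G : SimpleGraph V} (hG : G.Connected) (hV : 2 ≤ Fintype.card V) (v : V) : ∃ u, G.Adj v u := by
  have : Nontrivial V := Fintype.one_lt_card_iff_nontrivial.1 hV
  exact hG.preconnected.exists_adj_of_nontrivial v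

/-! ### Completion, termination, labels and message size -/

variable (hG : G.Connected) (hV : 2 ≤ Fintype.card V)
include hG hV

theorem known_run_eq {t : ℕ} (ht : (cover G).card + 2 +
    2 * (cover G).card * ((allTokens G N.ident).card + 1) ≤ t) (v : V) :
    (N.run t v).known = allTokens G N.ident := by
  refine (N.known_run_subset t v).antisymm fun x hx => ?_
  have hsrc : ∃ s, x ∈ (N.run ((cover G).card + 2) s).known := by
    obtain ⟨u, hu⟩ := (mem_allTokens G _).1 hx
    by_cases h : u ∈ cover G
    · exact ⟨u, N.mem_known_run_succ.2 (Or.inr (Or.inr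
        ((mem_ownTokens_of_ready (N.ready_run le_rfl u)).2 (Or.inl ⟨h, hu⟩))))⟩
    · obtain ⟨s, hs⟩ := hG.exists_adj_of_two_le_card hV u
      exact ⟨s, N.mem_known_run_succ.2 (Or.inr (Or.inr
        ((mem_ownTokens_of_ready (N.ready_run le_rfl s)).2 (Or.inr ⟨u, hs.symm, h, hu⟩))))⟩
  obtain ⟨s, hs⟩ := hsrc
  obtain ⟨p, hp⟩ := hG.exists_isPath s v
  refine N.known_run_mono ?_ v (N.mem_known_of_walk p hs)
  refine le_trans ?_ ht
  gcongr
  exact length_le_of_isPath p hp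

-- The cover has at most as many elements as there are tokens, so a quadratic function of the token
-- count exceeds the flooding time. The final +1 leaves the round that delivers the labels.
omit hG hV in
theorem stopTime_ge : (cover G).card + 2 + 2 * (cover G).card *
    ((allTokens G N.ident).card + 1) + 1 ≤ stopTime (allTokens G N.ident).card := by
  have := card_cover_le_card_allTokens G N.ident_injective
  rw [stopTime]
  nlinarith

/-- The full weight forces a node to know all tokens, so its local count is the global one. Hence
all nodes stop in the same round, and none falls silent while others still need it. -/
theorem finished_run_iff (t : ℕ) (v : V) :
    (N.run t v).Finished ↔ stopTime (allTokens G N.ident).card ≤ t := by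
  have hadj := hG.exists_adj_of_two_le_card hV
  rw [Finished, num_run, time_run]
  constructor
  · rintro ⟨h1, h2⟩
    rwa [eq_allTokens_of_sum_share G N.ident_injective hadj (N.known_run_subset t v) h1] at h2
  · intro h
    rw [N.known_run_eq hG hV (by have := N.stopTime_ge; omega) v]
    exact ⟨sum_share_allTokens G N.ident_injective hadj, h⟩

/-- One round more than `ready_run` needs, because the label comes from a message composed in the
preceding round. -/
theorem label_run {t : ℕ} (ht : (cover G).card + 3 ≤ t) (v : V) :
    (N.run t v).label = (DegreeCover.rep G N.ident v, DegreeCover.rank G N.ident v) := by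
  rw [label]
  by_cases hv : v ∈ cover G
  · rw [if_pos ((N.inCover_run (by omega) v).2 hv), ident_run, rep_of_mem G _ hv,
      rank_of_mem G _ hv]
  · rw [if_neg (mt (N.inCover_run (by omega) v).1 hv), time_run]
    obtain ⟨u, hu⟩ := hG.exists_adj_of_two_le_card hV v
    have hpos : 0 < G.degree v := (G.degree_pos_iff_exists_adj v).2 ⟨u, hu⟩
    have hh := N.hist_run_fin (show t - 1 < t by omega) v ⟨0, hpos⟩
    simp only at hh
    have hr := N.ready_run (show (cover G).card + 2 ≤ t - 1 by omega) (N.nbr v ⟨0, hpos⟩)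
    have hb := N.nbr_backPort v ⟨0, hpos⟩
    have hn : ¬ (N.run (t - 1) (N.nbr v ⟨0, hpos⟩)).NbrInCover (N.backPort v ⟨0, hpos⟩) := by
      rw [N.nbrInCover_run (by omega), hb]
      exact hv
    rw [hh]
    simp only [message]
    rw [if_pos ⟨hr, hn⟩, if_pos ⟨hr, hn⟩, nbrRep_of_ready hr _ (by rwa [hb]),
      nbrRank_of_ready hr _ (by rwa [hb]), hb]

omit hG in
theorem bounded_message_run (t : ℕ) (v : V) (i : Fin (G.degree v)) :
    ((N.run t v).message i).Bounded (Fintype.card V ^ (c + 2)) := by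
  classical
  set n := Fintype.card V
  -- The exponent c + 2 also leaves room for class sizes, which can be as large as n.
  have hn : n < n ^ (c + 2) := by
    calc n = n ^ 1 := (pow_one n).symm
      _ < n ^ (c + 2) := Nat.pow_lt_pow_right hV (by omega)
  have hid : ∀ u, N.ident u < n ^ (c + 2) := fun u =>
    (N.ident_lt u).trans_le (Nat.pow_le_pow_right (by omega) (by omega))
  have hrep : ∀ u, DegreeCover.rep G N.ident u < n ^ (c + 2) := by
    intro u
    obtain ⟨w, -, hw⟩ := exists_rep G N.ident u
    exact hw ▸ hid w
  have hdeg : ∀ u, G.degree u < n ^ (c + 2) := fun u => (G.degree_lt_card_verts u).trans hn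
  have hle : ∀ k, k ≤ n → k < n ^ (c + 2) := fun k hk => hk.trans_lt hn
  have hcond : ∀ {P : Prop} [Decidable P] (a : ℕ), (P → a < n ^ (c + 2)) →
      (if P then a else 0) < n ^ (c + 2) := by
    intro P _ a h
    split_ifs with hP
    · exact h hP
    · omega
  refine ⟨?_, ?_, ?_, ?_, ?_, ?_, ?_⟩
  · exact (N.ident_run t v).trans_lt (hid v)
  · exact (N.deg_run t v).trans_lt (hdeg v)
  · exact hcond 1 fun _ => by omega
  · simp only [message, time_run, nbrIdent]
    rcases t with _ | t
    · exact hle 0 (Nat.zero_le _)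
    · rw [N.hist_run (Nat.succ_pos t), received]
      split_ifs with h
      · exact (N.ident_run 0 _).trans_lt (hid _)
      · exact hle 0 (Nat.zero_le _)
  · refine hcond _ fun h => ?_
    rw [nbrRep_of_ready h.1 i (mt (N.nbrInCover_run (two_le_of_ready h.1) v i).2 h.2)]
    exact hrep _
  · refine hcond _ fun h => ?_
    rw [nbrRank_of_ready h.1 i (mt (N.nbrInCover_run (two_le_of_ready h.1) v i).2 h.2)]
    exact hle _ ((rank_lt G N.ident _).le.trans (card_twinClass_le G N.ident _))
  · intro x hx
    obtain ⟨u, hu⟩ := (mem_allTokens G _).1 (N.known_run_subset t v (mem_of_pending hx).1)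
    obtain ⟨y, hy, rfl⟩ := (mem_vertexTokens G _).1 hu
    obtain ⟨w, -, -, rfl⟩ := (mem_trace G _).1 hy
    exact ⟨hrep u, hle _ (card_twinClass_le G N.ident u),
      hle _ ((card_trace_le G N.ident u).trans (Finset.card_le_univ _)), hid w⟩

end CongestNetwork

/-! ### The actual run -/

namespace CongestNetwork

open DegreeCover FloodState

variable {V : Type} [Fintype V] {G : SimpleGraph V} [DecidableRel G.Adj] {c : ℕ}
  (N : CongestNetwork G c) {m : ℕ} (H : SimpleGraph (Fin m))

/-- Before the first output, the program runs as if nobody ever stopped. -/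
theorem state_eq_run {T : ℕ}
    (hT : ∀ t < T, ∀ v, (floodAlgorithm m H).output (N.run t v) = none) {t : ℕ} (ht : t ≤ T) :
    N.state (floodAlgorithm m H) t = N.run t := by
  induction t with
  | zero => rfl
  | succ t ih =>
    have ih := ih (by omega)
    have hnone := hT t (by omega)
    funext v
    have h1 : N.inbox (floodAlgorithm m H) (N.run t) v = fun i => if h : i < G.degree v then
        some ((N.run t (N.nbr v ⟨i, h⟩)).message (N.backPort v ⟨i, h⟩)).encode else none := by
      funext i
      by_cases h : i < G.degree v
      · have : (floodAlgorithm m H).output (N.run t (N.port v ⟨i, h⟩)) = none := hnone _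
        simp only [inbox, CongestAlgorithm.message, dif_pos h, this]
        rfl
      · simp only [inbox, dif_neg h]
    rw [state, ih, h1]
    simp only [CongestAlgorithm.next, hnone v]
    change (N.run t v).receive _ = (N.run t v).receive _
    congr 1
    funext i
    by_cases h : i < G.degree v
    · simp only [received, dif_pos h, Option.map_some, Option.getD_some,
        FloodMessage.decode_encode]
    · simp only [received, dif_neg h, Option.map_none, Option.getD_none]

/-- States are final once all nodes have stopped. -/
theorem state_eq_of_stopped {Output : Type} (A : CongestAlgorithm Output) {T : ℕ}
    {f : V → Output} (hT : N.OutputsWithin A T f) {t : ℕ} (ht : T ≤ t) :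
    N.state A t = N.state A T := by
  induction ht with
  | refl => rfl
  | step _ ih =>
    funext v
    rw [state, ih, CongestAlgorithm.next, hT v]

theorem OutputsWithin.mono {N : CongestNetwork G c} {Output : Type} {A : CongestAlgorithm Output}
    {T T' : ℕ} {f : V → Output} (hT : N.OutputsWithin A T f) (h : T ≤ T') :
    N.OutputsWithin A T' f := by
  intro v
  rw [N.state_eq_of_stopped A hT h]
  exact hT v

theorem flood_correct (hG : G.Connected) (hV : 2 ≤ Fintype.card V) :
    N.RespectsBandwidth (floodAlgorithm m H) (32 * (c + 2)) ∧
      ∃ f : V → Option (Fin m),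
        N.OutputsWithin (floodAlgorithm m H) (stopTime (allTokens G N.ident).card) f ∧
          IsMaximumCommonInducedSubgraph G H f := by
  classical
  set T := stopTime (allTokens G N.ident).card with hTdef
  have hadj := hG.exists_adj_of_two_le_card hV
  have hrun : ∀ t < T, ∀ v, (floodAlgorithm m H).output (N.run t v) = none := by
    intro t ht v
    simp only [floodAlgorithm]
    rw [if_neg (by rw [num_run]; omega), if_neg (by rw [N.finished_run_iff hG hV]; omega)]
  have hge := N.stopTime_ge
  have hout : N.OutputsWithin (floodAlgorithm m H) T
      (chosenSolution (allTokens G N.ident) H ∘ labelIso G N.ident_injective hadj) := by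
    intro v
    rw [N.state_eq_run H hrun le_rfl]
    simp only [floodAlgorithm]
    rw [if_neg (by rw [num_run]; omega), if_pos ((N.finished_run_iff hG hV T v).2 le_rfl),
      N.known_run_eq hG hV (by omega) v, N.label_run hG hV (by nlinarith) v,
      dif_pos (label_mem G N.ident_injective hadj v)]
    rfl
  refine ⟨?_, _, hout, ?_⟩
  · intro t v i hi k hk
    -- From round `T` on every node is silent, so only messages of the run without stopping matter.
    have hbefore : t < T := by
      by_contra hlt
      rw [N.state_eq_of_stopped _ hout (not_lt.1 hlt), CongestAlgorithm.message, hout v] at hk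
      simp at hk
    rw [N.state_eq_run H hrun hbefore.le] at hk
    simp only [CongestAlgorithm.message, hrun t hbefore v] at hk
    have hk' : ((N.run t v).message i).encode = k := Option.some.inj hk
    rw [← hk', Nat.size_le]
    calc ((N.run t v).message i).encode < (Fintype.card V ^ (c + 2)) ^ 32 :=
          FloodMessage.encode_lt (hV.trans (Nat.le_self_pow (by omega) _))
            (N.bounded_message_run hV t v ⟨i, hi⟩)
      _ ≤ ((2 ^ Nat.clog 2 (Fintype.card V)) ^ (c + 2)) ^ 32 := by
          gcongr
          exact Nat.le_pow_clog (by norm_num) _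
      _ = 2 ^ (32 * (c + 2) * Nat.clog 2 (Fintype.card V)) := by
          rw [← pow_mul, ← pow_mul]
          congr 1
          ring
  · have := (finite_labels (allTokens G N.ident)).to_subtype
    exact (exists_isMaximumCommonInducedSubgraph _ H).choose_spec.comp_iso _

theorem flood_correct_of_card_eq_one (hV : Fintype.card V = 1) (β : ℕ) (T : ℕ) :
    N.RespectsBandwidth (floodAlgorithm m H) β ∧
      ∃ f : V → Option (Fin m), N.OutputsWithin (floodAlgorithm m H) T f ∧
        IsMaximumCommonInducedSubgraph G H f := by
  have hsub : Subsingleton V := Fintype.card_le_one_iff_subsingleton.1 hV.le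
  obtain ⟨e⟩ : Nonempty (V ≃ Unit) := Fintype.card_eq.1 (by rw [hV]; rfl)
  let e' : G ≃g (⊥ : SimpleGraph Unit) :=
    ⟨e, fun {a b} => by simp [Subsingleton.elim a b]⟩
  have hout : N.OutputsWithin (floodAlgorithm m H) 0 (trivialSolution H ∘ e') := by
    intro v
    simp only [floodAlgorithm, state, start, hV, if_true]
    rfl
  refine ⟨?_, _, hout.mono (Nat.zero_le T),
    (exists_isMaximumCommonInducedSubgraph _ H).choose_spec.comp_iso e'⟩
  intro t v i hi
  have := G.degree_lt_card_verts v
  omega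

/-- The running time in terms of the vertex cover number. -/
theorem stopTime_le {τ : ℕ} (hτ : 1 ≤ τ) (h : G.vertexCoverNum ≤ τ) :
    stopTime (allTokens G N.ident).card ≤ 2 ^ (16 * τ ^ 2) := by
  classical
  obtain ⟨S, hS, hcov⟩ := G.vertexCoverNum_exists
  have hScard : S.toFinset.card ≤ τ := by
    rw [← hS, ← Set.coe_toFinset S, Set.encard_coe_eq_coe_finsetCard] at h
    simpa using h
  have hK : (cover G).card ≤ 2 * τ ^ 2 := by
    have h1 := card_cover_le (G := G) (S := S.toFinset) (by simpa using hcov)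
    nlinarith
  set K := (cover G).card
  have hN := card_allTokens_le G N.ident_injective
  have hK2 : K < 2 ^ K := Nat.lt_two_pow_self
  -- With K < 2^K, the token bound (K + 2^K)K is below 2·(2^K)².
  have hN' : (allTokens G N.ident).card + 1 ≤ 2 ^ (2 * K + 1) := by
    have : (2 : ℕ) ^ (2 * K + 1) = 2 * (2 ^ K) ^ 2 := by ring
    rw [this]
    nlinarith
  calc stopTime (allTokens G N.ident).card ≤ 2 ^ 4 * (2 ^ (2 * K + 1)) ^ 2 := by
        rw [stopTime]
        gcongr
        norm_num
    _ = 2 ^ (4 * K + 6) := by ring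
    -- Since K ≤ 2τ², the exponent is at most 8τ² + 6, and 6 ≤ 8τ² because τ ≥ 1.
    _ ≤ 2 ^ (16 * τ ^ 2) := Nat.pow_le_pow_right (by norm_num) (by nlinarith)

end CongestNetwork

theorem mainTheorem9 :
    ∃ C : ℕ, ∀ c : ℕ, ∃ β : ℕ,
      -- the program of the nodes may depend on the target graph, which every node knows
      ∃ A : (m : ℕ) → SimpleGraph (Fin m) → CongestAlgorithm (Option (Fin m)),
        ∀ (V : Type) [Fintype V] (G : SimpleGraph V) [DecidableRel G.Adj] (_ : G.Connected)
          (N : CongestNetwork G c) (m : ℕ) (H : SimpleGraph (Fin m)) (τ : ℕ)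
          (_ : max G.vertexCoverNum H.vertexCoverNum = (τ : ℕ∞)),
          N.RespectsBandwidth (A m H) β ∧
            ∃ f : V → Option (Fin m),
              N.OutputsWithin (A m H) (2 ^ (C * τ ^ 2)) f ∧
                IsMaximumCommonInducedSubgraph G H f := by
  refine ⟨16, fun c => ⟨32 * (c + 2), floodAlgorithm, ?_⟩⟩
  intro V _ G _ hG N m H τ hmax
  have hne : Nonempty V := hG.nonempty
  have hτ : G.vertexCoverNum ≤ τ := hmax ▸ le_max_left _ _
  rcases (Nat.succ_le_of_lt (Fintype.card_pos (α := V))).eq_or_lt with h1 | h1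
  · exact N.flood_correct_of_card_eq_one H h1.symm _ _
  · obtain ⟨hband, f, hout, hf⟩ := N.flood_correct H hG h1
    -- With at least two vertices a connected graph has an edge, which an empty set cannot cover.
    have hpos : 1 ≤ τ := by
      by_contra h0
      obtain rfl : τ = 0 := by omega
      obtain ⟨u, hu⟩ := hG.exists_adj_of_two_le_card h1 hne.some
      obtain ⟨S, hS, hcov⟩ := G.vertexCoverNum_exists
      have : S = ∅ := by
        rw [← Set.encard_eq_zero, hS]
        simpa using hτ
      simpa [this] using hcov hu
    exact ⟨hband, f, hout.mono (N.stopTime_le hpos hτ), hf⟩
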